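/- Let $(G_n)$ be a sequence of finite connected undirected simple graphs, each with at least two vertices, whose numbers of vertices $|G_n|$ tend to infinity. Let $K_n$ be the transition matrix of simple random walk on $G_n=(\mathcal X_n,E_n)$, i.e. $K_n(x,y)=1/\deg(x)$ if $\{x,y\}\in E_n$ and $K_n(x,y)=0$ otherwise, let $\pi_n$ be its unique stationary law, and let $P^{(n)}_t=e^{-t}\sum_{k\ge 0}\frac{t^k}{k!}K_n^k$ be the associated continuous-time semigroup. Assume that $(G_n)$ is an expander sequence: the degrees are bounded uniformly in $n$, and $\inf_n\gamma(K_n)>0$, where the Poincaré constant (spectral gap) is $$\gamma(K_n)=\inf_{f}\frac{\frac12\sum_{x,y}\pi_n(x)K_n(x,y)(f(x)-f(y))^2}{\mathrm{Var}_{\pi_n}(f)},$$ the infimum being over the non-constant functions $f:\mathcal X_n\to\mathbb R$. For $\varepsilon\in(0,1)$ and $t\ge 0$, set $$t^{(n)}_{\mathrm{mix}}(\varepsilon)=\min\Big\{t\ge 0:\ \max_{o\in\mathcal X_n}\tfrac12\sum_{x}\big|P^{(n)}_t(o,x)-\pi_n(x)\big|\le\varepsilon\Big\},\qquad V^{(n)}_{\mathrm{KL}}(t)=\max_{o\in\mathcal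 X_n}\mathrm{Var}_{\mu}\Big(\log\frac{\mu}{\pi_n}\Big)\ \text{ with }\mu=P^{(n)}_t(o,\cdot),$$ where $\mathrm{Var}_\mu$ denotes the variance under the probability vector $\mu$. Then the sequence exhibits cutoff, i.e. $$\forall\,\varepsilon,\varepsilon'\in(0,1),\qquad \frac{t^{(n)}_{\mathrm{mix}}(\varepsilon')}{t^{(n)}_{\mathrm{mix}}(\varepsilon)}\xrightarrow[n\to\infty]{}1,$$ if and only if $$\forall\,\varepsilon\in(0,1),\qquad \frac{V^{(n)}_{\mathrm{KL}}\big(t^{(n)}_{\mathrm{mix}}(\varepsilon)\big)}{(\log|G_n|)^2}\xrightarrow[n\to\infty]{}0.$$ -/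

import Mathlib

open Filter Topology

namespace MarkovCutoff

noncomputable section

section Chains

variable {V : Type*} [Fintype V]

/-- `π` is a probability vector solving the stationarity equation `π K = π`. -/
def IsStationary (K : Matrix V V ℝ) (π : V → ℝ) : Prop :=
  (∀ x, 0 ≤ π x) ∧ ∑ x, π x = 1 ∧ Matrix.vecMul π K = π

/-- The continuous-time semigroup `P_t(x,y) = e^{-t} ∑_k K^k(x,y) t^k / k!`. -/
def heatKernel [DecidableEq V] (K : Matrix V V ℝ) (t : ℝ) (x y : V) : ℝ :=
  Real.exp (-t) * ∑' k : ℕ, (K ^ k) x y * t ^ k / (k.factorial : ℝ)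

/-- Total variation distance between two probability vectors. -/
def tvDist (μ π : V → ℝ) : ℝ := (1 / 2) * ∑ x, |μ x - π x|

/-- Relative entropy `∑ μ log (μ / π)` (terms with `μ x = 0` vanish). -/
def klDiv (μ π : V → ℝ) : ℝ := ∑ x, μ x * Real.log (μ x / π x)

/-- Varentropy: the variance under `μ` of `log (μ / π)`. -/
def varentropy (μ π : V → ℝ) : ℝ :=
  ∑ x, μ x * (Real.log (μ x / π x) - klDiv μ π) ^ 2

/-- Worst-case total variation distance to equilibrium at time `t`. -/
def worstTV [DecidableEq V] (K : Matrix V V ℝ) (π : V → ℝ) (t : ℝ) : ℝ :=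
  ⨆ o : V, tvDist (heatKernel K t o) π

/-- Worst-case varentropy at time `t`. -/
def worstVarentropy [DecidableEq V] (K : Matrix V V ℝ) (π : V → ℝ) (t : ℝ) : ℝ :=
  ⨆ o : V, varentropy (heatKernel K t o) π

/-- The mixing time: the first `t ≥ 0` at which the worst-case total variation distance to
equilibrium is at most `ε`. -/
def tmix [DecidableEq V] (K : Matrix V V ℝ) (π : V → ℝ) (ε : ℝ) : ℝ :=
  sInf {t : ℝ | 0 ≤ t ∧ worstTV K π t ≤ ε}

/-- Variance of a function under the probability vector `π`. -/
def variance (π f : V → ℝ) : ℝ := ∑ x, π x * (f x - ∑ y, π y * f y) ^ 2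

/-- The Dirichlet form `(1/2) ∑ π(x) K(x,y) (f(x) - f(y))²`. -/
def dirichletForm (K : Matrix V V ℝ) (π f : V → ℝ) : ℝ :=
  (1 / 2) * ∑ x, ∑ y, π x * K x y * (f x - f y) ^ 2

/-- The Poincaré constant: the infimum of the Dirichlet form over the variance, among functions
of positive variance. For a reversible `K` this is the spectral gap. -/
def poincareConst (K : Matrix V V ℝ) (π : V → ℝ) : ℝ :=
  sInf {r : ℝ | ∃ f : V → ℝ, 0 < variance π f ∧ r = dirichletForm K π f / variance π f}

end Chains

/-- Cutoff for a sequence of chains `K n` with stationary laws `π n`. -/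
def ExhibitsCutoff {V : ℕ → Type*} [∀ n, Fintype (V n)] [∀ n, DecidableEq (V n)]
    (K : ∀ n, Matrix (V n) (V n) ℝ) (π : ∀ n, V n → ℝ) : Prop :=
  ∀ ε ∈ Set.Ioo (0 : ℝ) 1, ∀ ε' ∈ Set.Ioo (0 : ℝ) 1,
    Tendsto (fun n => tmix (K n) (π n) ε' / tmix (K n) (π n) ε) atTop (𝓝 1)

section Graphs

variable {V : Type*} [Fintype V] (G : SimpleGraph V) [DecidableRel G.Adj]

/-- Transition matrix of simple random walk on `G`. -/
def srw : Matrix V V ℝ := fun x y => if G.Adj x y then 1 / (G.degree x : ℝ) else 0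

/-- The stationary law of simple random walk; `isStationary_iff` shows that on a connected graph
with at least two vertices it is the only solution of the stationarity equation. -/
def srwStationary (x : V) : ℝ := (G.degree x : ℝ) / ∑ y, (G.degree y : ℝ)

variable {G}

theorem srw_row_sum (hG : G.Connected) [Nontrivial V] (x : V) : ∑ y, srw G x y = 1 := by
  classical
  have hd : (G.degree x : ℝ) ≠ 0 := by
    exact_mod_cast (hG.preconnected.degree_pos_of_nontrivial x).ne'
  simp only [srw, ← Finset.sum_filter, Finset.sum_const, nsmul_eq_mul]
  rw [← SimpleGraph.neighborFinset_eq_filter, SimpleGraph.card_neighborFinset_eq_degree]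
  field_simp

theorem isStationary_iff (hG : G.Connected) [Nontrivial V] (π : V → ℝ) :
    IsStationary (srw G) π ↔ π = srwStationary G := by
  classical
  have hd : ∀ x, (0 : ℝ) < G.degree x := fun x => by
    exact_mod_cast hG.preconnected.degree_pos_of_nontrivial x
  have hS : (0 : ℝ) < ∑ y, (G.degree y : ℝ) :=
    Finset.sum_pos (fun y _ => hd y) Finset.univ_nonempty
  constructor
  · rintro ⟨-, h1, h2⟩
    have hL : Matrix.mulVec (G.lapMatrix ℝ) (fun x => π x / G.degree x) = 0 := by
      funext y
      rw [SimpleGraph.lapMatrix_mulVec_apply]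
      have h := congrFun h2 y
      simp only [Matrix.vecMul, dotProduct, srw] at h
      have e : ∑ u ∈ G.neighborFinset y, π u / (G.degree u : ℝ) = π y := by
        rw [← h, SimpleGraph.neighborFinset_eq_filter, Finset.sum_filter]
        refine Finset.sum_congr rfl fun u _ => ?_
        by_cases a : G.Adj u y
        · rw [if_pos a, if_pos a.symm]; ring
        · rw [if_neg a, if_neg (fun b => a b.symm)]; ring
      rw [e]
      have := (hd y).ne'
      simp only [Pi.zero_apply]
      field_simp
      ring
    have hc := (SimpleGraph.lapMatrix_mulVec_eq_zero_iff_forall_reachable G).1 hL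
    obtain ⟨a⟩ : Nonempty V := inferInstance
    have hx : ∀ x, π x = π a / G.degree a * G.degree x := fun x => by
      have := hc x a (hG.preconnected x a)
      rw [← this]
      have := (hd x).ne'
      field_simp
    have hs : π a / G.degree a * ∑ y, (G.degree y : ℝ) = 1 := by
      rw [Finset.mul_sum, ← h1]
      exact Finset.sum_congr rfl fun x _ => (hx x).symm
    funext x
    rw [hx x, srwStationary, eq_div_iff hS.ne', mul_right_comm, hs, one_mul]
  · rintro rfl
    refine ⟨fun x => div_nonneg (hd x).le hS.le, ?_, ?_⟩
    · simp only [srwStationary, ← Finset.sum_div]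
      exact div_self hS.ne'
    · funext y
      simp only [Matrix.vecMul, dotProduct, srw, srwStationary]
      have e : ∀ u, (G.degree u : ℝ) / (∑ z, (G.degree z : ℝ)) *
          (if G.Adj u y then 1 / (G.degree u : ℝ) else 0) =
          if G.Adj y u then 1 / ∑ z, (G.degree z : ℝ) else 0 := fun u => by
        have := (hd u).ne'
        by_cases a : G.Adj u y
        · rw [if_pos a, if_pos a.symm]; field_simp
        · rw [if_neg a, if_neg (fun b => a b.symm), mul_zero]
      rw [Finset.sum_congr rfl fun u _ => e u, ← Finset.sum_filter, Finset.sum_const, nsmul_eq_mul,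
        ← SimpleGraph.neighborFinset_eq_filter, SimpleGraph.card_neighborFinset_eq_degree]
      ring

end Graphs

/-- An expander sequence: finite connected graphs, of size tending to infinity, whose degrees are
uniformly bounded and whose simple random walks have Poincaré constants bounded away from `0`. -/
structure IsExpanderSequence {V : ℕ → Type*} [∀ n, Fintype (V n)]
    (G : ∀ n, SimpleGraph (V n)) [∀ n, DecidableRel (G n).Adj] : Prop where
  connected : ∀ n, (G n).Connected
  card_tendsto : Tendsto (fun n => Fintype.card (V n)) atTop atTop
  sparse : ∃ Δ : ℕ, ∀ n x, (G n).degree x ≤ Δ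
  expansion : ∃ c : ℝ, 0 < c ∧ ∀ n, c ≤ poincareConst (srw (G n)) (srwStationary (G n))

end

end MarkovCutoff

/-! On an expander sequence every mixing time is of order `log |G_n|`: the spectral gap gives the
upper bound, and bounded degree the lower one, because a walk reaches few vertices in a short time.
Cutoff therefore means that any two mixing times differ by `o(log |G_n|)`.

Small varentropy gives cutoff. Let `μ` be the law at a time when its distance to `π` is at most `1 -
δ`. By Chebyshev, `log (μ / π)` is within `b` of its mean `D` off a set of small `μ`-mass, with `b`
of the order of the root of the varentropy. The remaining bulk must carry `π`-mass at least `δ / 2`,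
which forces `D - b` to be bounded, so the density there is at most `(2 / δ) exp (2 b)`
(`exists_density_le`). From such a density the gap finishes the mixing in extra time `O(b + 1)`
(`tvDist_evolve_le`, `tmix_le_add`), which is `o(log |G_n|)`.

Cutoff gives small varentropy. Let `A` be the set where the density at time `t` exceeds `|G_n| ^ k`;
it has at most about `|G_n| ^ (1 - k)` points. During a window `s = o(log |G_n|)` the walk moves a
distance at most `ζ log |G_n|` with high probability, so the mass of `A` ends in a thickening of `A`
whose `π`-mass still vanishes when `ζ` is small compared with `k`. By cutoff the walk is nearly
mixed at `t + s`, hence that mass was small (`sum_heatKernel_le`). Since the log-density never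
exceeds `log |G_n| + O(1)`, and densities below one contribute `O(1)`, the varentropy is a small
multiple of `(log |G_n|) ^ 2` (`varentropy_le_of_tail`, `worstVarentropy_le`). -/

namespace MarkovCutoff

/-! ### The heat kernel as a matrix exponential. -/

section HeatKernel

variable {V : Type*} [Fintype V] [DecidableEq V]

attribute [local instance] Matrix.linftyOpNormedRing Matrix.linftyOpNormedAlgebra
  Matrix.linftyOpNormedAddCommGroup

theorem hasSum_heatKernel (K : Matrix V V ℝ) (t : ℝ) (x y : V) :
    HasSum (fun k : ℕ => (K ^ k) x y * t ^ k / (k.factorial : ℝ))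
      (NormedSpace.exp (t • K) x y) := by
  have h := NormedSpace.exp_series_hasSum_exp' (𝕂 := ℝ) (t • K)
  have h2 := (Pi.hasSum.1 ((Pi.hasSum.1 h) x)) y
  have e : (fun k : ℕ => (K ^ k) x y * t ^ k / (k.factorial : ℝ)) =
      fun k : ℕ => (((k.factorial : ℝ)⁻¹ • (t • K) ^ k : Matrix V V ℝ)) x y := by
    funext k
    rw [smul_pow, Matrix.smul_apply, Matrix.smul_apply, smul_eq_mul, smul_eq_mul]
    ring
  rw [e]
  exact h2

theorem heatKernel_eq_exp (K : Matrix V V ℝ) (t : ℝ) (x y : V) :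
    heatKernel K t x y = NormedSpace.exp (t • (K - 1)) x y := by
  rw [heatKernel, (hasSum_heatKernel K t x y).tsum_eq]
  have e : t • (K - 1) = Matrix.diagonal (fun _ => -t) + t • K := by
    rw [← Matrix.smul_one_eq_diagonal]; module
  have e2 : NormedSpace.exp (t • (K - 1)) = Real.exp (-t) • NormedSpace.exp (t • K) := by
    rw [e, Matrix.exp_add_of_commute, Matrix.exp_diagonal, Pi.exp_def, ← Matrix.smul_one_eq_diagonal,
      Real.exp_eq_exp_ℝ, smul_mul_assoc, one_mul]
    rw [← Matrix.smul_one_eq_diagonal]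
    exact (Commute.one_left _).smul_left _
  rw [e2, Matrix.smul_apply, smul_eq_mul]

theorem hasSum_heatKernel' (K : Matrix V V ℝ) (t : ℝ) (x y : V) :
    HasSum (fun k : ℕ => Real.exp (-t) * ((K ^ k) x y * t ^ k / (k.factorial : ℝ)))
      (heatKernel K t x y) := by
  rw [heatKernel]
  exact (hasSum_heatKernel K t x y).summable.hasSum.mul_left _

theorem heatKernel_zero (K : Matrix V V ℝ) (x y : V) :
    heatKernel K 0 x y = if x = y then 1 else 0 := by
  rw [heatKernel_eq_exp, zero_smul, NormedSpace.exp_zero, Matrix.one_apply]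

theorem heatKernel_add (K : Matrix V V ℝ) (s t : ℝ) (x y : V) :
    heatKernel K (s + t) x y = ∑ z, heatKernel K s x z * heatKernel K t z y := by
  simp only [heatKernel_eq_exp]
  rw [add_smul, Matrix.exp_add_of_commute, Matrix.mul_apply]
  exact ((Commute.refl (K - 1)).smul_left s).smul_right t

theorem hasDerivAt_heatKernel (K : Matrix V V ℝ) (t : ℝ) (x y : V) :
    HasDerivAt (fun t => heatKernel K t x y)
      (∑ z, K x z * heatKernel K t z y - heatKernel K t x y) t := by
  have h := hasDerivAt_exp_smul_const' (𝕂 := ℝ) (K - 1) t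
  have h2 := (hasDerivAt_pi.1 ((hasDerivAt_pi.1 h) x)) y
  simp only [heatKernel_eq_exp]
  refine HasDerivAt.congr_deriv h2 ?_
  have e := congrFun (congrFun (sub_one_mul K (NormedSpace.exp (t • (K - 1)))) x) y
  rw [Matrix.sub_apply, Matrix.mul_apply] at e
  exact e

theorem continuous_heatKernel (K : Matrix V V ℝ) (x y : V) :
    Continuous (fun t => heatKernel K t x y) :=
  continuous_iff_continuousAt.2 fun t => (hasDerivAt_heatKernel K t x y).continuousAt

end HeatKernel

/-- A stochastic matrix `K` in detailed balance with a positive probability vector `π`. -/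
structure IsReversibleChain {V : Type*} [Fintype V] (K : Matrix V V ℝ) (π : V → ℝ) : Prop where
  nonneg : ∀ x y, 0 ≤ K x y
  row_sum : ∀ x, ∑ y, K x y = 1
  pos : ∀ x, 0 < π x
  sum_eq_one : ∑ x, π x = 1
  balance : ∀ x y, π x * K x y = π y * K y x

/-! ### Reversible chains: Dirichlet form and decay of variance. -/

namespace IsReversibleChain

variable {V : Type*} [Fintype V] {K : Matrix V V ℝ} {π : V → ℝ}

/-- Dirichlet form as minus the inner product with the generator. -/
theorem sum_mul_generator (h : IsReversibleChain K π) (f : V → ℝ) (m : ℝ) :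
    ∑ x, π x * (f x - m) * (∑ y, K x y * f y - f x) = -dirichletForm K π f := by
  have e : ∀ x, π x * (f x - m) * (∑ y, K x y * f y - f x) =
      ∑ y, π x * K x y * ((f x - m) * (f y - f x)) := fun x => by
    have : f x = ∑ y, K x y * f x := by rw [← Finset.sum_mul, h.row_sum, one_mul]
    conv_lhs => rw [show ∑ y, K x y * f y - f x = ∑ y, (K x y * f y - K x y * f x) by
      rw [Finset.sum_sub_distrib, ← this]]
    rw [Finset.mul_sum]
    exact Finset.sum_congr rfl fun y _ => by ring
  -- Detailed balance makes the double sum symmetric in `x` and `y`; averaging the two forms turns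
  -- it into a sum of squares and cancels the shift `m`.
  have e1 : ∑ x, ∑ y, π x * K x y * ((f x - m) * (f y - f x)) =
      ∑ x, ∑ y, π x * K x y * ((f y - m) * (f x - f y)) := by
    rw [Finset.sum_comm]
    exact Finset.sum_congr rfl fun x _ => Finset.sum_congr rfl fun y _ => by rw [h.balance]
  have e2 : ∑ x, ∑ y, π x * K x y * ((f x - m) * (f y - f x)) +
      ∑ x, ∑ y, π x * K x y * ((f y - m) * (f x - f y)) =
      -∑ x, ∑ y, π x * K x y * (f x - f y) ^ 2 := by
    simp only [← Finset.sum_add_distrib, ← Finset.sum_neg_distrib]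
    exact Finset.sum_congr rfl fun x _ => Finset.sum_congr rfl fun y _ => by ring
  rw [Finset.sum_congr rfl fun x _ => e x, dirichletForm]
  linarith

variable [DecidableEq V]

theorem pow_nonneg (h : IsReversibleChain K π) (k : ℕ) (x y : V) : 0 ≤ (K ^ k) x y := by
  induction k generalizing x y with
  | zero => rw [pow_zero, Matrix.one_apply]; split_ifs <;> norm_num
  | succ k ih =>
    rw [pow_succ, Matrix.mul_apply]
    exact Finset.sum_nonneg fun z _ => mul_nonneg (ih x z) (h.nonneg z y)

theorem pow_row_sum (h : IsReversibleChain K π) (k : ℕ) (x : V) : ∑ y, (K ^ k) x y = 1 := by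
  induction k generalizing x with
  | zero => simp [Matrix.one_apply]
  | succ k ih =>
    simp only [pow_succ, Matrix.mul_apply]
    rw [Finset.sum_comm]
    simp only [← Finset.mul_sum, h.row_sum, mul_one, ih]

theorem pow_balance (h : IsReversibleChain K π) (k : ℕ) (x y : V) :
    π x * (K ^ k) x y = π y * (K ^ k) y x := by
  induction k generalizing x y with
  | zero =>
    simp only [pow_zero, Matrix.one_apply]
    by_cases a : x = y
    · rw [a]
    · rw [if_neg a, if_neg (Ne.symm a)]; simp
  | succ k ih =>
    conv_lhs => rw [pow_succ, Matrix.mul_apply, Finset.mul_sum]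
    conv_rhs => rw [pow_succ', Matrix.mul_apply, Finset.mul_sum]
    refine Finset.sum_congr rfl fun z _ => ?_
    rw [← mul_assoc, ih, mul_right_comm, h.balance]
    ring

theorem heatKernel_nonneg (h : IsReversibleChain K π) {t : ℝ} (ht : 0 ≤ t) (x y : V) :
    0 ≤ heatKernel K t x y :=
  (hasSum_heatKernel' K t x y).nonneg fun k => by
    have := h.pow_nonneg k x y
    positivity

theorem heatKernel_row_sum (h : IsReversibleChain K π) (t : ℝ) (x : V) :
    ∑ y, heatKernel K t x y = 1 := by
  have h1 := hasSum_sum fun y (_ : y ∈ Finset.univ) => hasSum_heatKernel' K t x y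
  simp only [← Finset.mul_sum, ← Finset.sum_mul, ← Finset.sum_div, h.pow_row_sum, one_mul] at h1
  have h2 : HasSum (fun k : ℕ => Real.exp (-t) * (t ^ k / (k.factorial : ℝ)))
      (Real.exp (-t) * Real.exp t) := by
    rw [Real.exp_eq_exp_ℝ]
    exact (NormedSpace.expSeries_div_hasSum_exp t).mul_left _
  rw [h1.unique h2, ← Real.exp_add, neg_add_cancel, Real.exp_zero]

theorem heatKernel_balance (h : IsReversibleChain K π) (t : ℝ) (x y : V) :
    π x * heatKernel K t x y = π y * heatKernel K t y x := by
  have h1 := (hasSum_heatKernel' K t x y).mul_left (π x)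
  have h2 := (hasSum_heatKernel' K t y x).mul_left (π y)
  refine h1.unique ?_
  convert h2 using 2 with k
  linear_combination (Real.exp (-t) * t ^ k / (k.factorial : ℝ)) * h.pow_balance k x y

theorem sum_mul_heatKernel (h : IsReversibleChain K π) (t : ℝ) (f : V → ℝ) :
    ∑ x, π x * ∑ y, heatKernel K t x y * f y = ∑ y, π y * f y := by
  simp only [Finset.mul_sum]
  rw [Finset.sum_comm]
  refine Finset.sum_congr rfl fun y _ => ?_
  simp only [← mul_assoc, h.heatKernel_balance t _ y]
  rw [← Finset.sum_mul, ← Finset.mul_sum, h.heatKernel_row_sum, mul_one]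

/-- Exponential decay of the variance along the semigroup, from a Poincaré inequality. -/
theorem variance_heatKernel_le (h : IsReversibleChain K π) {c : ℝ}
    (hc : ∀ f : V → ℝ, c * variance π f ≤ dirichletForm K π f) {t : ℝ} (ht : 0 ≤ t) (f : V → ℝ) :
    variance π (fun x => ∑ y, heatKernel K t x y * f y) ≤
      Real.exp (-(2 * c * t)) * variance π f := by
  set m := ∑ y, π y * f y with hm
  let u : ℝ → V → ℝ := fun t x => ∑ y, heatKernel K t x y * f y
  have hu : ∀ t x, HasDerivAt (fun t => u t x) (∑ y, K x y * u t y - u t x) t := fun t x => by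
    have := HasDerivAt.fun_sum (u := Finset.univ)
      fun y _ => (hasDerivAt_heatKernel K t x y).mul_const (f y)
    refine this.congr_deriv ?_
    simp only [sub_mul, Finset.sum_sub_distrib, u, Finset.mul_sum, Finset.sum_mul]
    rw [Finset.sum_comm]
    simp only [mul_assoc]
  have hv : ∀ t, variance π (u t) = ∑ x, π x * (u t x - m) ^ 2 := fun t => by
    simp only [variance, u, h.sum_mul_heatKernel, ← hm]
  have hd : ∀ t, HasDerivAt (fun t => Real.exp (2 * c * t) * variance π (u t))
      (Real.exp (2 * c * t) * (2 * (c * variance π (u t) - dirichletForm K π (u t)))) t :=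
    fun t => by
    have h1 : HasDerivAt (fun t => variance π (u t)) (-2 * dirichletForm K π (u t)) t := by
      simp only [hv]
      have := HasDerivAt.fun_sum (u := Finset.univ)
        fun x _ => (((hu t x).sub_const m).pow 2).const_mul (π x)
      refine this.congr_deriv ?_
      rw [neg_mul, ← mul_neg, ← h.sum_mul_generator (u t) m, Finset.mul_sum]
      exact Finset.sum_congr rfl fun x _ => by push_cast; ring
    have h2 : HasDerivAt (fun t => Real.exp (2 * c * t)) (Real.exp (2 * c * t) * (2 * c)) t := by
      simpa using ((hasDerivAt_id t).const_mul (2 * c)).exp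
    exact (h2.mul h1).congr_deriv (by ring)
  -- Grönwall: the Poincaré inequality makes the derivative in `hd` nonpositive.
  have ha : Antitone (fun t => Real.exp (2 * c * t) * variance π (u t)) := by
    refine antitone_of_deriv_nonpos (fun t => (hd t).differentiableAt) fun t => ?_
    rw [(hd t).deriv]
    exact mul_nonpos_of_nonneg_of_nonpos (Real.exp_pos _).le (by linarith [hc (u t)])
  have h0 := ha ht
  have hu0 : u 0 = f := by
    funext x
    simp [u, heatKernel_zero]
  simp only [mul_zero, Real.exp_zero, one_mul, hu0] at h0
  rw [Real.exp_neg, ← div_eq_inv_mul, le_div_iff₀ (Real.exp_pos _), mul_comm]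
  exact h0

end IsReversibleChain

/-! ### Mixing in total variation from a bounded density. -/

section TotalVariation

variable {V : Type*} [Fintype V]

theorem sum_sub_sum_le_tvDist [DecidableEq V] {μ π : V → ℝ} (h : ∑ x, μ x = ∑ x, π x)
    (S : Finset V) : ∑ x ∈ S, μ x - ∑ x ∈ S, π x ≤ tvDist μ π := by
  have h1 : ∑ x ∈ S, (μ x - π x) ≤ ∑ x ∈ S, |μ x - π x| :=
    Finset.sum_le_sum fun x _ => le_abs_self _
  have h2 : ∑ x ∈ Sᶜ, -(μ x - π x) ≤ ∑ x ∈ Sᶜ, |μ x - π x| :=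
    Finset.sum_le_sum fun x _ => neg_le_abs _
  have h3 := Finset.sum_add_sum_compl S fun x => |μ x - π x|
  have h4 := Finset.sum_add_sum_compl S fun x => μ x - π x
  rw [Finset.sum_sub_distrib] at h1
  rw [Finset.sum_neg_distrib] at h2
  rw [Finset.sum_sub_distrib, Finset.sum_sub_distrib (s := Finset.univ)] at h4
  rw [tvDist]
  linarith

variable [DecidableEq V] {K : Matrix V V ℝ} {π : V → ℝ}

theorem tvDist_le_worstTV (K : Matrix V V ℝ) (π : V → ℝ) (t : ℝ) (o : V) :
    tvDist (heatKernel K t o) π ≤ worstTV K π t :=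
  le_ciSup (f := fun o => tvDist (heatKernel K t o) π) (Set.finite_range _).bddAbove o

theorem varentropy_le_worstVarentropy (K : Matrix V V ℝ) (π : V → ℝ) (t : ℝ) (o : V) :
    varentropy (heatKernel K t o) π ≤ worstVarentropy K π t :=
  le_ciSup (f := fun o => varentropy (heatKernel K t o) π) (Set.finite_range _).bddAbove o

namespace IsReversibleChain

/-- Convergence to equilibrium in `ℓ¹`, started from a bounded density. -/
theorem sum_abs_heatKernel_sub_le (h : IsReversibleChain K π) {c : ℝ}
    (hc : ∀ f : V → ℝ, c * variance π f ≤ dirichletForm K π f) {t : ℝ} (ht : 0 ≤ t)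
    {g : V → ℝ} {B : ℝ} (hB : 0 ≤ B) (hg : ∀ x, |g x| ≤ B) :
    ∑ y, |∑ x, π x * g x * heatKernel K t x y - (∑ x, π x * g x) * π y| ≤
      Real.exp (-(c * t)) * B := by
  set u : V → ℝ := fun y => ∑ x, heatKernel K t y x * g x with hu
  set m := ∑ x, π x * g x with hm
  have e : ∀ y, |∑ x, π x * g x * heatKernel K t x y - m * π y| = π y * |u y - m| := fun y => by
    rw [← abs_of_pos (h.pos y), ← abs_mul, abs_of_pos (h.pos y), hu, mul_sub, Finset.mul_sum,
      mul_comm m]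
    congr 2
    refine Finset.sum_congr rfl fun x _ => ?_
    linear_combination g x * h.heatKernel_balance t x y
  have h1 : (∑ y, π y * |u y - m|) ^ 2 ≤ variance π u := by
    have h2 := Real.pow_arith_mean_le_arith_mean_pow Finset.univ π (fun y => |u y - m|)
      (fun y _ => (h.pos y).le) h.sum_eq_one (fun y _ => abs_nonneg _) 2
    simpa only [sq_abs, variance, hu, h.sum_mul_heatKernel, ← hm] using h2
  have h3 : variance π g ≤ B ^ 2 := by
    have e : variance π g = ∑ x, π x * g x ^ 2 - m ^ 2 := by
      have : ∀ x, π x * (g x - m) ^ 2 = π x * g x ^ 2 - 2 * m * (π x * g x) + m ^ 2 * π x :=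
        fun x => by ring
      rw [variance, Finset.sum_congr rfl fun x _ => this x, Finset.sum_add_distrib,
        Finset.sum_sub_distrib, ← Finset.mul_sum, ← Finset.mul_sum, h.sum_eq_one, ← hm]
      ring
    have h4 : ∑ x, π x * g x ^ 2 ≤ ∑ x, π x * B ^ 2 := Finset.sum_le_sum fun x _ =>
      mul_le_mul_of_nonneg_left (sq_le_sq.2 ((hg x).trans (le_abs_self B))) (h.pos x).le
    rw [← Finset.sum_mul, h.sum_eq_one, one_mul] at h4
    nlinarith [sq_nonneg m]
  rw [Finset.sum_congr rfl fun y _ => e y]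
  refine le_of_sq_le_sq ?_ (by positivity)
  calc (∑ y, π y * |u y - m|) ^ 2 ≤ variance π u := h1
    _ ≤ Real.exp (-(2 * c * t)) * variance π g := h.variance_heatKernel_le hc ht g
    _ ≤ Real.exp (-(2 * c * t)) * B ^ 2 := mul_le_mul_of_nonneg_left h3 (Real.exp_pos _).le
    _ = (Real.exp (-(c * t)) * B) ^ 2 := by
      rw [mul_pow, ← Real.exp_nat_mul]; congr 2; push_cast; ring

/-- Mixing from a law whose density is bounded by `B` on a set `A`. -/
theorem tvDist_evolve_le (h : IsReversibleChain K π) {c : ℝ}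
    (hc : ∀ f : V → ℝ, c * variance π f ≤ dirichletForm K π f) {t : ℝ} (ht : 0 ≤ t)
    {μ : V → ℝ} (hμ : ∀ x, 0 ≤ μ x) (hμ1 : ∑ x, μ x = 1) {B : ℝ} (hB : 0 ≤ B) (A : Finset V)
    (hA : ∀ x ∈ A, μ x ≤ B * π x) :
    tvDist (fun y => ∑ x, μ x * heatKernel K t x y) π ≤
      (1 - ∑ x ∈ A, μ x) + 1 / 2 * (Real.exp (-(c * t)) * B) := by
  -- Split `μ = π g + ν`: the density `g`, bounded by `B`, relaxes through the gap, and the leftover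
  -- `ν` off `A` costs at most its mass.
  let g : V → ℝ := fun x => if x ∈ A then μ x / π x else 0
  let ν : V → ℝ := fun x => if x ∈ A then 0 else μ x
  have hg : ∀ x, |g x| ≤ B := fun x => by
    by_cases hx : x ∈ A
    · simp only [g, if_pos hx]
      rw [abs_of_nonneg (div_nonneg (hμ x) (h.pos x).le), div_le_iff₀ (h.pos x)]
      exact hA x hx
    · simpa only [g, if_neg hx, abs_zero] using hB
  have hs : ∀ x, μ x = π x * g x + ν x := fun x => by
    by_cases hx : x ∈ A
    · simp only [g, ν, if_pos hx]
      field_simp [(h.pos x).ne']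
      ring
    · simp [g, ν, if_neg hx]
  have hν : ∀ x, 0 ≤ ν x := fun x => by
    simp only [ν]; split_ifs; exacts [le_rfl, hμ x]
  have hν1 : ∑ x, ν x = 1 - ∑ x ∈ A, μ x := by
    rw [← hμ1, ← Finset.sum_add_sum_compl A μ, add_sub_cancel_left]
    simp only [ν, Finset.compl_eq_univ_sdiff, Finset.sum_ite, Finset.sum_const_zero, zero_add]
    congr 1
    ext x
    simp
  have hm : ∑ x, π x * g x = 1 - ∑ x, ν x := by
    rw [← hμ1, ← Finset.sum_sub_distrib]
    exact Finset.sum_congr rfl fun x _ => by rw [hs x]; ring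
  have key : ∑ y, |∑ x, μ x * heatKernel K t x y - π y| ≤
      Real.exp (-(c * t)) * B + 2 * ∑ x, ν x := by
    have h1 : ∀ y, |∑ x, μ x * heatKernel K t x y - π y| ≤
        |∑ x, π x * g x * heatKernel K t x y - (∑ x, π x * g x) * π y| +
          (∑ x, ν x * heatKernel K t x y + (∑ x, ν x) * π y) := fun y => by
      have e : ∑ x, μ x * heatKernel K t x y - π y =
          (∑ x, π x * g x * heatKernel K t x y - (∑ x, π x * g x) * π y) +
            (∑ x, ν x * heatKernel K t x y - (∑ x, ν x) * π y) := by
        have : ∑ x, μ x * heatKernel K t x y =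
            ∑ x, π x * g x * heatKernel K t x y + ∑ x, ν x * heatKernel K t x y := by
          rw [← Finset.sum_add_distrib]
          exact Finset.sum_congr rfl fun x _ => by rw [hs x]; ring
        rw [this, hm]
        ring
      rw [e]
      have h2 : 0 ≤ ∑ x, ν x * heatKernel K t x y :=
        Finset.sum_nonneg fun x _ => mul_nonneg (hν x) (h.heatKernel_nonneg ht x y)
      have h3 : 0 ≤ (∑ x, ν x) * π y :=
        mul_nonneg (Finset.sum_nonneg fun x _ => hν x) (h.pos y).le
      refine (abs_add_le _ _).trans (add_le_add le_rfl ?_)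
      rw [abs_le]
      constructor <;> linarith
    refine (Finset.sum_le_sum fun y _ => h1 y).trans ?_
    rw [Finset.sum_add_distrib, Finset.sum_add_distrib, ← Finset.mul_sum, h.sum_eq_one, mul_one]
    have h2 : ∑ y, ∑ x, ν x * heatKernel K t x y = ∑ x, ν x := by
      rw [Finset.sum_comm]
      simp only [← Finset.mul_sum, h.heatKernel_row_sum, mul_one]
    have h3 := h.sum_abs_heatKernel_sub_le hc ht hB hg
    linarith
  rw [tvDist]
  linarith

end IsReversibleChain

end TotalVariation

/-! ### Bounded degree and the speed of the walk. -/

section Growth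

variable {V : Type*} [DecidableEq V]

/-- The `m`-th iterated neighbourhood of `A` for the neighbourhood map `N`. -/
def thicken (N : V → Finset V) (A : Finset V) : ℕ → Finset V
  | 0 => A
  | m + 1 => thicken N A m ∪ (thicken N A m).biUnion N

theorem card_thicken_le {N : V → Finset V} {Δ : ℕ} (hN : ∀ x, (N x).card ≤ Δ) (A : Finset V)
    (m : ℕ) : (thicken N A m).card ≤ (1 + Δ) ^ m * A.card := by
  induction m with
  | zero => simp [thicken]
  | succ m ih =>
    calc (thicken N A (m + 1)).card
        ≤ (thicken N A m).card + ((thicken N A m).biUnion N).card := Finset.card_union_le _ _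
      _ ≤ (thicken N A m).card + (thicken N A m).card * Δ :=
        Nat.add_le_add_left (Finset.card_biUnion_le_card_mul _ _ _ fun x _ => hN x) _
      _ = (1 + Δ) * (thicken N A m).card := by ring
      _ ≤ (1 + Δ) * ((1 + Δ) ^ m * A.card) := Nat.mul_le_mul_left _ ih
      _ = (1 + Δ) ^ (m + 1) * A.card := by ring

variable [Fintype V] {K : Matrix V V ℝ} {π : V → ℝ} {N : V → Finset V}

namespace IsReversibleChain

theorem sum_thicken_pow (h : IsReversibleChain K π) (hN : ∀ x y, y ∉ N x → K x y = 0)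
    {A : Finset V} {x : V} (hx : x ∈ A) {k m : ℕ} (hk : k ≤ m) :
    ∑ y ∈ thicken N A m, (K ^ k) x y = 1 := by
  have hsupp : ∀ k, ∀ m ≥ k, ∀ y, y ∉ thicken N A m → (K ^ k) x y = 0 := by
    intro k
    induction k with
    | zero =>
      intro m _ y hy
      have : x ∈ thicken N A m := by
        clear hy hk
        induction m with
        | zero => exact hx
        | succ m ih => exact Finset.mem_union_left _ (ih (Nat.zero_le _))
      rw [pow_zero, Matrix.one_apply, if_neg]
      rintro rfl
      exact hy this
    | succ k ih =>
      rintro (_ | m) hm y hy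
      · omega
      rw [pow_succ, Matrix.mul_apply]
      refine Finset.sum_eq_zero fun z _ => ?_
      by_cases hz : z ∈ thicken N A m
      · rw [hN z y, mul_zero]
        exact fun hy' => hy (Finset.mem_union_right _ (Finset.mem_biUnion.2 ⟨z, hz, hy'⟩))
      · rw [ih m (by omega) z hz, zero_mul]
  rw [← h.pow_row_sum k x]
  exact Finset.sum_subset (Finset.subset_univ _) fun y _ hy => hsupp k m hk y hy

/-- In time `t` the walk stays within distance `m` with probability at least `1 - t / m`. -/
theorem le_sum_thicken_heatKernel (h : IsReversibleChain K π) (hN : ∀ x y, y ∉ N x → K x y = 0)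
    {A : Finset V} {x : V} (hx : x ∈ A) {m : ℕ} (hm : 0 < m) {t : ℝ} (ht : 0 ≤ t) :
    1 - t / m ≤ ∑ y ∈ thicken N A m, heatKernel K t x y := by
  have h1 := hasSum_sum fun y (_ : y ∈ thicken N A m) => hasSum_heatKernel' K t x y
  simp only [← Finset.mul_sum, ← Finset.sum_mul, ← Finset.sum_div] at h1
  have hexp : HasSum (fun k : ℕ => t ^ k / (k.factorial : ℝ)) (Real.exp t) := by
    rw [Real.exp_eq_exp_ℝ]
    exact NormedSpace.expSeries_div_hasSum_exp t
  -- The mean of the Poisson number of jumps; the probability estimate is Markov's inequality,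
  -- through the pointwise bound of the indicator of `k ≤ m` from below by `1 - k / m`.
  have hexp1 : HasSum (fun k : ℕ => (k : ℝ) * (t ^ k / (k.factorial : ℝ))) (t * Real.exp t) := by
    rw [← hasSum_nat_add_iff' 1]
    simp only [Finset.range_one, Finset.sum_singleton, Nat.cast_zero, zero_mul, sub_zero]
    have e : (fun k : ℕ => ((k + 1 : ℕ) : ℝ) * (t ^ (k + 1) / ((k + 1).factorial : ℝ))) =
        fun k : ℕ => t * (t ^ k / (k.factorial : ℝ)) := by
      funext k
      rw [Nat.factorial_succ]
      push_cast
      field_simp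
      exact pow_succ' t k
    rw [e]
    exact hexp.mul_left t
  have h2 := ((hexp.sub (hexp1.mul_left ((m : ℝ)⁻¹))).mul_left (Real.exp (-t)))
  have e : Real.exp (-t) * (Real.exp t - (m : ℝ)⁻¹ * (t * Real.exp t)) = 1 - t / m := by
    have : Real.exp (-t) * Real.exp t = 1 := by rw [← Real.exp_add]; simp
    linear_combination (1 - (m : ℝ)⁻¹ * t) * this
  rw [e] at h2
  refine hasSum_le (fun k => mul_le_mul_of_nonneg_left ?_ (Real.exp_pos _).le) h2 h1
  have hm' : (0 : ℝ) < m := by exact_mod_cast hm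
  have hk : 1 - (m : ℝ)⁻¹ * k ≤ ∑ y ∈ thicken N A m, (K ^ k) x y := by
    rcases le_total k m with hk | hk
    · rw [h.sum_thicken_pow hN hx hk]
      have : 0 ≤ (m : ℝ)⁻¹ * k := by positivity
      linarith
    · have h3 : (1 : ℝ) ≤ (m : ℝ)⁻¹ * k := by
        rw [← div_eq_inv_mul, le_div_iff₀ hm', one_mul]
        exact_mod_cast hk
      linarith [Finset.sum_nonneg fun y (_ : y ∈ thicken N A m) => h.pow_nonneg k x y]
  have := mul_le_mul_of_nonneg_right hk (by positivity : 0 ≤ t ^ k / (k.factorial : ℝ))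
  calc _ = (1 - (m : ℝ)⁻¹ * k) * (t ^ k / (k.factorial : ℝ)) := by ring
    _ ≤ _ := this
    _ = _ := by ring

/-- Mass cannot be spread out too quickly: if `P_t(o, ·)` charges `A`, then `P_{t+s}(o, ·)` charges
a thickening of `A`. -/
theorem sum_heatKernel_le (h : IsReversibleChain K π) (hN : ∀ x y, y ∉ N x → K x y = 0)
    (A : Finset V) (o : V) {m : ℕ} (hm : 0 < m) {s t : ℝ} (hs : 0 ≤ s) (ht : 0 ≤ t) :
    ∑ x ∈ A, heatKernel K t o x ≤
      worstTV K π (t + s) + s / m + ∑ x ∈ thicken N A m, π x := by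
  have hsum : ∑ x, heatKernel K (t + s) o x = ∑ x, π x := by
    rw [h.heatKernel_row_sum, h.sum_eq_one]
  have h1 := (sum_sub_sum_le_tvDist hsum (thicken N A m)).trans (tvDist_le_worstTV K π (t + s) o)
  have hA : ∑ x ∈ A, heatKernel K t o x ≤ 1 := by
    rw [← h.heatKernel_row_sum t o]
    exact Finset.sum_le_univ_sum_of_nonneg fun x => h.heatKernel_nonneg ht o x
  have hA0 : 0 ≤ ∑ x ∈ A, heatKernel K t o x :=
    Finset.sum_nonneg fun x _ => h.heatKernel_nonneg ht o x
  have h2 : (∑ x ∈ A, heatKernel K t o x) * (1 - s / m) ≤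
      ∑ y ∈ thicken N A m, heatKernel K (t + s) o y := by
    simp only [heatKernel_add]
    rw [Finset.sum_comm, Finset.sum_mul]
    refine (Finset.sum_le_sum fun x hx => ?_).trans
      (Finset.sum_le_univ_sum_of_nonneg (s := A) fun x => ?_)
    · rw [← Finset.mul_sum]
      exact mul_le_mul_of_nonneg_left (h.le_sum_thicken_heatKernel hN hx hm hs)
        (h.heatKernel_nonneg ht o x)
    · exact Finset.sum_nonneg fun y _ =>
        mul_nonneg (h.heatKernel_nonneg ht o x) (h.heatKernel_nonneg hs x y)
  have h3 : 0 ≤ s / m := by positivity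
  nlinarith

end IsReversibleChain
end Growth

/-! ### Varentropy against the size of the density. -/

section Varentropy

variable {V : Type*} [Fintype V] {μ π : V → ℝ}

theorem varentropy_nonneg (hμ : ∀ x, 0 ≤ μ x) : 0 ≤ varentropy μ π :=
  Finset.sum_nonneg fun x _ => mul_nonneg (hμ x) (sq_nonneg _)

theorem varentropy_le_sum_sq (hμ1 : ∑ x, μ x = 1) :
    varentropy μ π ≤ ∑ x, μ x * Real.log (μ x / π x) ^ 2 := by
  set D := klDiv μ π with hD
  have e : ∀ x, μ x * (Real.log (μ x / π x) - D) ^ 2 =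
      μ x * Real.log (μ x / π x) ^ 2 - 2 * D * (μ x * Real.log (μ x / π x)) + D ^ 2 * μ x :=
    fun x => by ring
  rw [varentropy, ← hD, Finset.sum_congr rfl fun x _ => e x, Finset.sum_add_distrib,
    Finset.sum_sub_distrib, ← Finset.mul_sum, ← Finset.mul_sum, hμ1]
  have : ∑ x, μ x * Real.log (μ x / π x) = D := rfl
  rw [this]
  nlinarith [sq_nonneg D]

/-- Chebyshev's inequality for the log-density gives an upper bound on the density, off a set of
small mass, provided `μ` is not too far from `π` in total variation. -/
theorem exists_density_le [DecidableEq V] (hμ : ∀ x, 0 ≤ μ x) (hμ1 : ∑ x, μ x = 1)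
    (hπ : ∀ x, 0 < π x) (hπ1 : ∑ x, π x = 1) {δ η b : ℝ} (hδ : 0 < δ)
    (htv : tvDist μ π ≤ 1 - δ) (hb : 0 < b) (hη : η ≤ δ / 2)
    (hV : varentropy μ π ≤ b ^ 2 * η) :
    ∃ A : Finset V, 1 - ∑ x ∈ A, μ x ≤ η ∧
      ∀ x ∈ A, μ x ≤ 2 / δ * Real.exp (2 * b) * π x := by
  classical
  set D := klDiv μ π with hD
  -- Positivity of `μ x` is required because `Real.log 0 = 0` would let points without mass into
  -- `A`, and the lower bound in `hlt` would fail there.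
  let A : Finset V := {x | 0 < μ x ∧ |Real.log (μ x / π x) - D| < b}
  have hA : ∀ x, x ∈ A ↔ 0 < μ x ∧ |Real.log (μ x / π x) - D| < b := fun x => by simp [A]
  have h1 : 1 - ∑ x ∈ A, μ x ≤ η := by
    have h2 : b ^ 2 * ∑ x ∈ Aᶜ, μ x ≤ varentropy μ π := by
      rw [Finset.mul_sum]
      refine (Finset.sum_le_sum fun x hx => ?_).trans (Finset.sum_le_univ_sum_of_nonneg
        (s := Aᶜ) fun x => mul_nonneg (hμ x) (sq_nonneg (Real.log (μ x / π x) - D)))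
      rw [Finset.mem_compl, hA, not_and_or, not_lt, not_lt] at hx
      rcases hx with hx | hx
      · simp [le_antisymm hx (hμ x)]
      · rw [mul_comm]
        refine mul_le_mul_of_nonneg_left ?_ (hμ x)
        rw [← sq_abs (Real.log (μ x / π x) - D)]
        gcongr
    have h3 := le_of_mul_le_mul_left (h2.trans hV) (by positivity)
    have := Finset.sum_add_sum_compl A μ
    linarith
  have hlt : ∀ x ∈ A, π x * Real.exp (D - b) ≤ μ x ∧ μ x ≤ π x * Real.exp (D + b) := by
    intro x hx
    obtain ⟨h2, h3⟩ := (hA x).1 hx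
    obtain ⟨h4, h5⟩ := abs_lt.1 h3
    have h6 : 0 < μ x / π x := div_pos h2 (hπ x)
    have e : μ x = π x * Real.exp (Real.log (μ x / π x)) := by
      rw [Real.exp_log h6, mul_div_cancel₀ _ (hπ x).ne']
    constructor
    · conv_rhs => rw [e]
      exact mul_le_mul_of_nonneg_left (Real.exp_le_exp.2 (by linarith)) (hπ x).le
    · conv_lhs => rw [e]
      exact mul_le_mul_of_nonneg_left (Real.exp_le_exp.2 (by linarith)) (hπ x).le
  refine ⟨A, h1, fun x hx => (hlt x hx).2.trans ?_⟩
  -- The entropy `D` is not known, so it is eliminated: the lower bound on the density over `A`, a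
  -- set of `π`-mass at least `δ / 2`, keeps `exp (D - b)` below `2 / δ`.
  have hπA : (∑ x ∈ A, π x) * Real.exp (D - b) ≤ 1 := by
    rw [← hμ1, Finset.sum_mul]
    exact (Finset.sum_le_sum fun x hx => (hlt x hx).1).trans
      (Finset.sum_le_univ_sum_of_nonneg hμ)
  have h7 := (sum_sub_sum_le_tvDist (hμ1.trans hπ1.symm) A).trans htv
  have h8 : δ / 2 ≤ ∑ x ∈ A, π x := by linarith
  have h9 : Real.exp (D - b) ≤ 2 / δ := by
    rw [le_div_iff₀ hδ]
    nlinarith [Real.exp_pos (D - b)]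
  calc π x * Real.exp (D + b) = Real.exp (D - b) * Real.exp (2 * b) * π x := by
        rw [← Real.exp_add, mul_comm]; congr 2; ring
    _ ≤ 2 / δ * Real.exp (2 * b) * π x :=
      mul_le_mul_of_nonneg_right (mul_le_mul_of_nonneg_right h9 (Real.exp_pos _).le) (hπ x).le

/-- The varentropy is controlled by the mass where the density is large. -/
theorem varentropy_le_of_tail (hμ : ∀ x, 0 ≤ μ x) (hμ1 : ∑ x, μ x = 1)
    (hπ : ∀ x, 0 < π x) (hπ1 : ∑ x, π x = 1) {κ Λ : ℝ}
    (hΛ : ∀ x, μ x ≤ Real.exp Λ * π x) (A : Finset V)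
    (hA : ∀ x, π x * Real.exp κ ≤ μ x → x ∈ A) :
    varentropy μ π ≤ κ ^ 2 + Λ ^ 2 * ∑ x ∈ A, μ x + 4 := by
  classical
  refine (varentropy_le_sum_sq hμ1).trans ?_
  have hx : ∀ x, μ x * Real.log (μ x / π x) ^ 2 ≤
      κ ^ 2 * μ x + Λ ^ 2 * (if x ∈ A then μ x else 0) + 4 * π x := by
    intro x
    have h0 := hπ x
    have h0' : 0 ≤ Λ ^ 2 * (if x ∈ A then μ x else 0) := by
      have := hμ x
      split_ifs <;> positivity
    have h0'' : 0 ≤ κ ^ 2 * μ x := mul_nonneg (sq_nonneg _) (hμ x)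
    rcases (hμ x).eq_or_lt with h1 | h1
    · rw [← h1]; simp only [zero_mul, mul_zero, ite_self]; linarith
    set f := μ x / π x with hf
    have hf0 : 0 < f := div_pos h1 h0
    have e : μ x = π x * f := by rw [hf, mul_div_cancel₀ _ h0.ne']
    rcases le_total f 1 with h2 | h2
    -- Applying `|u log u| < 1` at `u = √f` gives `f log² f ≤ 4`, the source of the additive `4`.
    · have h3 := Real.abs_log_mul_self_lt (Real.sqrt f) (Real.sqrt_pos.2 hf0)
        (Real.sqrt_le_one.2 h2)
      rw [Real.log_sqrt hf0.le] at h3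
      have h4 : (Real.log f / 2 * Real.sqrt f) ^ 2 ≤ 1 := by
        rw [← sq_abs]
        exact pow_le_one₀ (abs_nonneg _) h3.le
      rw [mul_pow, Real.sq_sqrt hf0.le] at h4
      have h5 : μ x * Real.log f ^ 2 ≤ 4 * π x := by
        rw [e]
        nlinarith [mul_le_mul_of_nonneg_left h4 h0.le]
      linarith
    · have hl : 0 ≤ Real.log f := Real.log_nonneg h2
      rcases le_total (Real.log f) κ with h3 | h3
      · have : Real.log f ^ 2 ≤ κ ^ 2 := by gcongr
        nlinarith
      · have hxA : x ∈ A := hA x (by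
          rw [e]
          exact mul_le_mul_of_nonneg_left ((Real.le_log_iff_exp_le hf0).1 h3) h0.le)
        rw [if_pos hxA]
        have h4 : Real.log f ≤ Λ := by
          rw [Real.log_le_iff_le_exp hf0, hf, div_le_iff₀ h0]
          exact hΛ x
        have : Real.log f ^ 2 ≤ Λ ^ 2 := by gcongr
        nlinarith
  refine (Finset.sum_le_sum fun x _ => hx x).trans ?_
  rw [Finset.sum_add_distrib, Finset.sum_add_distrib, ← Finset.mul_sum, ← Finset.mul_sum,
    ← Finset.mul_sum, hμ1, hπ1, Finset.sum_ite_mem, Finset.univ_inter]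
  linarith

end Varentropy

/-! ### Mixing times and their windows. -/

section MixingTime

variable {V : Type*} [Fintype V] [DecidableEq V] {K : Matrix V V ℝ} {π : V → ℝ}

theorem tmix_nonneg (K : Matrix V V ℝ) (π : V → ℝ) (ε : ℝ) : 0 ≤ tmix K π ε :=
  Real.sInf_nonneg fun _ h => h.1

theorem tmix_le {ε t : ℝ} (ht : 0 ≤ t) (h : worstTV K π t ≤ ε) : tmix K π ε ≤ t :=
  csInf_le ⟨0, fun _ h => h.1⟩ ⟨ht, h⟩

theorem worstTV_le_iff [Nonempty V] {t ε : ℝ} :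
    worstTV K π t ≤ ε ↔ ∀ o, tvDist (heatKernel K t o) π ≤ ε :=
  ciSup_le_iff (Set.finite_range _).bddAbove

theorem continuous_tvDist_heatKernel (K : Matrix V V ℝ) (π : V → ℝ) (o : V) :
    Continuous fun t => tvDist (heatKernel K t o) π :=
  continuous_const.mul (continuous_finsetSum _ fun x _ =>
    ((continuous_heatKernel K o x).sub continuous_const).abs)

namespace IsReversibleChain

/-- A point mass has density at most `B`, so `tvDist_evolve_le` applies with `A` the whole space.
This also makes the set defining `tmix` nonempty, without which its infimum would take the default
value `0`. -/
theorem worstTV_le [Nonempty V] (h : IsReversibleChain K π) {c : ℝ} (hc0 : 0 < c)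
    (hc : ∀ f : V → ℝ, c * variance π f ≤ dirichletForm K π f) {B : ℝ} (hB : 1 ≤ B)
    (hπB : ∀ x, 1 ≤ B * π x) {ε : ℝ} (hε : 0 < ε) (hε1 : ε ≤ 1) :
    worstTV K π (Real.log (B / ε) / c) ≤ ε := by
  have hBε : 1 ≤ B / ε := (one_le_div hε).2 (hε1.trans hB)
  have ht : 0 ≤ Real.log (B / ε) / c := div_nonneg (Real.log_nonneg hBε) hc0.le
  rw [worstTV_le_iff]
  intro o
  have h1 := h.tvDist_evolve_le hc ht (μ := fun x => if o = x then 1 else 0)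
    (fun x => by positivity) (by simp) (zero_le_one.trans hB) Finset.univ (fun x _ => by
      have := hπB x
      split_ifs <;> linarith)
  simp only [ite_mul, one_mul, zero_mul, Finset.sum_ite_eq, Finset.mem_univ, if_true, sub_self,
    zero_add] at h1
  refine h1.trans ?_
  rw [mul_div_cancel₀ _ hc0.ne', Real.exp_neg, Real.exp_log (by positivity)]
  have : (B / ε)⁻¹ * B = ε := by
    have : B ≠ 0 := by positivity
    field_simp
  rw [this]
  linarith

/-- Continuity in time makes the defining set closed, so the infimum is attained. -/
theorem worstTV_tmix_le [Nonempty V] {ε : ℝ} (hex : ∃ t, 0 ≤ t ∧ worstTV K π t ≤ ε) :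
    worstTV K π (tmix K π ε) ≤ ε := by
  have hcl : IsClosed {t : ℝ | 0 ≤ t ∧ worstTV K π t ≤ ε} := by
    simp only [worstTV_le_iff, Set.ofPred_and, Set.ofPred_forall]
    exact isClosed_Ici.inter (isClosed_iInter fun o =>
      isClosed_le (continuous_tvDist_heatKernel K π o) continuous_const)
  exact (hcl.csInf_mem hex ⟨0, fun _ h => h.1⟩).2

theorem tmix_anti {ε ε' : ℝ} (hle : ε ≤ ε') (hex : ∃ t, 0 ≤ t ∧ worstTV K π t ≤ ε) :
    tmix K π ε' ≤ tmix K π ε :=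
  csInf_le_csInf ⟨0, fun _ h => h.1⟩ hex fun _ ht => ⟨ht.1, ht.2.trans hle⟩

/-- The width of the mixing window is controlled by the varentropy at the start of the window. -/
theorem tmix_le_add [Nonempty V] (h : IsReversibleChain K π) {c : ℝ} (hc0 : 0 < c)
    (hc : ∀ f : V → ℝ, c * variance π f ≤ dirichletForm K π f) {δ ε b η t : ℝ} (ht : 0 ≤ t)
    (hδ : 0 < δ) (hδ1 : δ ≤ 1) (hε : 0 < ε) (hε1 : ε ≤ 1) (hb : 0 < b) (hηδ : η ≤ δ / 2)
    (hηε : η ≤ ε / 2) (htv : worstTV K π t ≤ 1 - δ)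
    (hV : worstVarentropy K π t ≤ b ^ 2 * η) :
    tmix K π ε ≤ t + (2 * b + Real.log (2 / (δ * ε))) / c := by
  set s := (2 * b + Real.log (2 / (δ * ε))) / c with hs
  have hs0 : 0 ≤ s := by
    have : 0 ≤ Real.log (2 / (δ * ε)) := Real.log_nonneg (by
      rw [one_le_div (by positivity)]
      nlinarith)
    positivity
  refine tmix_le (by positivity) (worstTV_le_iff.2 fun o => ?_)
  obtain ⟨A, hA1, hA2⟩ := exists_density_le (fun x => h.heatKernel_nonneg ht o x)
    (h.heatKernel_row_sum t o) h.pos h.sum_eq_one hδ (worstTV_le_iff.1 htv o) hb hηδ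
    ((varentropy_le_worstVarentropy K π t o).trans hV)
  have h1 := h.tvDist_evolve_le hc hs0 (fun x => h.heatKernel_nonneg ht o x)
    (h.heatKernel_row_sum t o) (by positivity) A hA2
  have e : (fun y => ∑ x, heatKernel K t o x * heatKernel K s x y) = heatKernel K (t + s) o :=
    funext fun y => (heatKernel_add K t s o y).symm
  rw [e] at h1
  -- The duration `s` was chosen for this identity; the total error is then at most `η + ε / 2 ≤ ε`.
  have e2 : Real.exp (-(c * s)) * (2 / δ * Real.exp (2 * b)) = ε := by
    rw [hs, mul_div_cancel₀ _ hc0.ne', neg_add, Real.exp_add, Real.exp_neg (Real.log _),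
      Real.exp_log (by positivity), Real.exp_neg]
    field_simp
  rw [e2] at h1
  linarith

variable {N : V → Finset V} {Δ : ℕ}

omit [Fintype V] in
theorem sum_thicken_le (hN : ∀ x, (N x).card ≤ Δ) {p : ℝ} (hp : ∀ x, π x ≤ p) (hp0 : 0 ≤ p)
    (A : Finset V) (m : ℕ) : ∑ x ∈ thicken N A m, π x ≤ (1 + Δ : ℝ) ^ m * A.card * p := by
  refine (Finset.sum_le_sum fun x _ => hp x).trans ?_
  rw [Finset.sum_const, nsmul_eq_mul]
  refine mul_le_mul_of_nonneg_right ?_ hp0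
  exact_mod_cast card_thicken_le hN A m

/-- Diameter-type lower bound on the time needed to mix. -/
theorem le_of_worstTV [Nonempty V] (h : IsReversibleChain K π)
    (hK : ∀ x y, y ∉ N x → K x y = 0) (hN : ∀ x, (N x).card ≤ Δ) {p : ℝ} (hp : ∀ x, π x ≤ p)
    (hp0 : 0 ≤ p) {m : ℕ} (hm : 0 < m) {s : ℝ} (hs : 0 ≤ s) :
    1 ≤ worstTV K π s + s / m + (1 + Δ : ℝ) ^ m * p := by
  obtain ⟨o⟩ : Nonempty V := inferInstance
  -- At time `0` all the mass sits on the single point `o`.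
  have h1 := h.sum_heatKernel_le hK {o} o hm hs le_rfl
  have h2 := sum_thicken_le hN hp hp0 {o} m
  simp only [Finset.sum_singleton, heatKernel_zero, if_true, zero_add, Finset.card_singleton,
    Nat.cast_one, mul_one] at h1 h2
  linarith

/-- If the chain is nearly mixed at time `t + s`, with `s` small, then its varentropy at time `t`
is small. -/
theorem worstVarentropy_le [Nonempty V] (h : IsReversibleChain K π)
    (hK : ∀ x y, y ∉ N x → K x y = 0) (hN : ∀ x, (N x).card ≤ Δ) {p Λ κ : ℝ}
    (hp : ∀ x, π x ≤ p) (hp0 : 0 ≤ p) (hΛ : ∀ x, 1 ≤ Real.exp Λ * π x) {m : ℕ} (hm : 0 < m) {s t : ℝ} (hs : 0 ≤ s) (ht : 0 ≤ t) :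
    worstVarentropy K π t ≤ κ ^ 2 + Λ ^ 2 * (worstTV K π (t + s) + s / m +
      (1 + Δ : ℝ) ^ m * (Real.exp Λ * Real.exp (-κ)) * p) + 4 := by
  classical
  refine ciSup_le fun o => ?_
  let A : Finset V := {x | π x * Real.exp κ ≤ heatKernel K t o x}
  have hA : ∀ x, x ∈ A ↔ π x * Real.exp κ ≤ heatKernel K t o x := fun x => by simp [A]
  have h0 := fun x => h.heatKernel_nonneg ht o x
  have h1 := varentropy_le_of_tail h0 (h.heatKernel_row_sum t o) h.pos h.sum_eq_one
    (Λ := Λ) (fun x => by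
      refine le_trans ?_ (hΛ x)
      rw [← h.heatKernel_row_sum t o]
      exact Finset.single_le_sum (fun x _ => h0 x) (Finset.mem_univ x)) A fun x => (hA x).2
  refine h1.trans ?_
  -- Each point of `A` carries mass at least `exp (κ - Λ)`, and the total mass is one.
  have hcard : (A.card : ℝ) ≤ Real.exp Λ * Real.exp (-κ) := by
    have h2 : (A.card : ℝ) * Real.exp κ ≤ Real.exp Λ := by
      calc (A.card : ℝ) * Real.exp κ = ∑ x ∈ A, Real.exp κ := by
            rw [Finset.sum_const, nsmul_eq_mul]
        _ ≤ ∑ x ∈ A, Real.exp Λ * heatKernel K t o x := Finset.sum_le_sum fun x hx => by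
            have h3 := mul_le_mul_of_nonneg_left ((hA x).1 hx) (Real.exp_pos Λ).le
            have h4 := mul_le_mul_of_nonneg_right (hΛ x) (Real.exp_pos κ).le
            linarith
        _ ≤ Real.exp Λ * 1 := by
            rw [← Finset.mul_sum, ← h.heatKernel_row_sum t o]
            exact mul_le_mul_of_nonneg_left (Finset.sum_le_univ_sum_of_nonneg h0)
              (Real.exp_pos _).le
        _ = _ := mul_one _
    rwa [Real.exp_neg, ← div_eq_mul_inv, le_div_iff₀ (Real.exp_pos _)]
  have h2 := h.sum_heatKernel_le hK A o hm hs ht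
  have h3 := sum_thicken_le hN hp hp0 A m
  have h4 : (1 + Δ : ℝ) ^ m * A.card * p ≤
      (1 + Δ : ℝ) ^ m * (Real.exp Λ * Real.exp (-κ)) * p := by gcongr
  have := mul_le_mul_of_nonneg_left (h2.trans (add_le_add le_rfl (h3.trans h4))) (sq_nonneg Λ)
  linarith

end IsReversibleChain
end MixingTime

/-! ### From expander graphs to expanding sequences of chains. -/

theorem mul_variance_le_dirichletForm {V : Type*} [Fintype V] {K : Matrix V V ℝ} {π : V → ℝ}
    (hK : ∀ x y, 0 ≤ K x y) (hπ : ∀ x, 0 ≤ π x) {c : ℝ} (hc : c ≤ poincareConst K π) (f : V → ℝ) :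
    c * variance π f ≤ dirichletForm K π f := by
  have hE : ∀ f, 0 ≤ dirichletForm K π f := fun f => mul_nonneg (by norm_num)
    (Finset.sum_nonneg fun x _ => Finset.sum_nonneg fun y _ =>
      mul_nonneg (mul_nonneg (hπ x) (hK x y)) (sq_nonneg _))
  have hv : 0 ≤ variance π f := Finset.sum_nonneg fun x _ => mul_nonneg (hπ x) (sq_nonneg _)
  rcases hv.eq_or_lt with h | h
  · rw [← h, mul_zero]
    exact hE f
  · rw [← le_div_iff₀ h]
    refine hc.trans (csInf_le ⟨0, ?_⟩ ⟨f, h, rfl⟩)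
    rintro r ⟨g, hg, rfl⟩
    exact div_nonneg (hE g) hg.le

/-- Reversible chains of size about `exp (L n)` with local moves and a uniform Poincaré
inequality. -/
structure IsExpandingSequence {V : ℕ → Type*} [∀ n, Fintype (V n)]
    (K : ∀ n, Matrix (V n) (V n) ℝ) (π : ∀ n, V n → ℝ) (N : ∀ n, V n → Finset (V n))
    (Δ : ℕ) (c : ℝ) (L : ℕ → ℝ) : Prop where
  chain : ∀ n, IsReversibleChain (K n) (π n)
  gap_pos : 0 < c
  poincare : ∀ n f, c * variance (π n) f ≤ dirichletForm (K n) (π n) f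
  eq_zero : ∀ n x y, y ∉ N n x → K n x y = 0
  card_le : ∀ n x, (N n x).card ≤ Δ
  one_le : 1 ≤ Δ
  nonneg : ∀ n, 0 ≤ L n
  le_mass : ∀ n x, 1 ≤ Real.exp (Real.log Δ + L n) * π n x
  mass_le : ∀ n x, π n x ≤ Δ * Real.exp (-L n)
  tendsto : Tendsto L atTop atTop

theorem srw_isReversibleChain {V : Type*} [Fintype V] [Nontrivial V] {G : SimpleGraph V}
    [DecidableRel G.Adj] (hG : G.Connected) : IsReversibleChain (srw G) (srwStationary G) := by
  have hd : ∀ x, (0 : ℝ) < G.degree x := fun x => by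
    exact_mod_cast hG.preconnected.degree_pos_of_nontrivial x
  have hS : (0 : ℝ) < ∑ y, (G.degree y : ℝ) :=
    Finset.sum_pos (fun y _ => hd y) Finset.univ_nonempty
  refine ⟨fun x y => ?_, srw_row_sum hG, fun x => div_pos (hd x) hS,
    ((isStationary_iff hG _).2 rfl).2.1, fun x y => ?_⟩
  · have := hd x
    simp only [srw]
    split_ifs <;> positivity
  · have h1 := (hd x).ne'
    have h2 := (hd y).ne'
    simp only [srw, srwStationary, G.adj_comm y x]
    split_ifs
    · field_simp
    · simp

/-- Degrees lie in `[1, Δ]`, so `π` is uniform up to a factor `Δ` either way; the scale is `L = log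
|V|`. -/
theorem IsExpanderSequence.isExpandingSequence {V : ℕ → Type*} [∀ n, Fintype (V n)]
    [∀ n, Nontrivial (V n)] {G : ∀ n, SimpleGraph (V n)} [∀ n, DecidableRel (G n).Adj]
    (hG : IsExpanderSequence G) :
    ∃ Δ c, IsExpandingSequence (fun n => srw (G n)) (fun n => srwStationary (G n))
      (fun n x => (G n).neighborFinset x) Δ c (fun n => Real.log (Fintype.card (V n))) := by
  obtain ⟨Δ, hΔ⟩ := hG.sparse
  obtain ⟨c, hc0, hc⟩ := hG.expansion
  have hd : ∀ n x, (1 : ℝ) ≤ (G n).degree x := fun n x => by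
    exact_mod_cast (hG.connected n).preconnected.degree_pos_of_nontrivial x
  have hd' : ∀ n x, ((G n).degree x : ℝ) ≤ Δ := fun n x => by exact_mod_cast hΔ n x
  have hΔ1 : 1 ≤ Δ := by
    obtain ⟨x⟩ : Nonempty (V 0) := inferInstance
    exact_mod_cast (hd 0 x).trans (hd' 0 x)
  have hΔ0 : (0 : ℝ) < Δ := by exact_mod_cast hΔ1
  have hcard : ∀ n, (0 : ℝ) < Fintype.card (V n) := fun n => by exact_mod_cast Fintype.card_pos
  have hS1 : ∀ n, (Fintype.card (V n) : ℝ) ≤ ∑ y, ((G n).degree y : ℝ) := fun n => by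
    simpa using Finset.sum_le_sum fun y (_ : y ∈ Finset.univ) => hd n y
  have hS2 : ∀ n, ∑ y, ((G n).degree y : ℝ) ≤ Δ * Fintype.card (V n) := fun n => by
    simpa [mul_comm] using Finset.sum_le_sum fun y (_ : y ∈ Finset.univ) => hd' n y
  have hch := fun n => srw_isReversibleChain (hG.connected n)
  refine ⟨Δ, c, hch, hc0, fun n => mul_variance_le_dirichletForm (hch n).nonneg
    (fun x => ((hch n).pos x).le) (hc n), fun n x y hy => ?_, fun n x => ?_, hΔ1, fun n => ?_,
    fun n x => ?_, fun n x => ?_, ?_⟩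
  · rw [SimpleGraph.mem_neighborFinset] at hy
    exact if_neg hy
  · rw [SimpleGraph.card_neighborFinset_eq_degree]
    exact hΔ n x
  · exact Real.log_nonneg (by exact_mod_cast Fintype.card_pos)
  · rw [Real.exp_add, Real.exp_log hΔ0, Real.exp_log (hcard n), srwStationary, mul_div_assoc',
      one_le_div ((hcard n).trans_le (hS1 n))]
    nlinarith [hS2 n, hd n x, mul_pos hΔ0 (hcard n)]
  · rw [Real.exp_neg, Real.exp_log (hcard n), srwStationary, ← div_eq_mul_inv]
    exact div_le_div₀ hΔ0.le (hd' n x) (hcard n) (hS1 n)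
  · exact Real.tendsto_log_atTop.comp (tendsto_natCast_atTop_atTop.comp hG.card_tendsto)

/-! ### Asymptotics: varentropy and cutoff. -/

namespace IsExpandingSequence

variable {V : ℕ → Type*} [∀ n, Fintype (V n)] [∀ n, DecidableEq (V n)] [∀ n, Nonempty (V n)]
  {K : ∀ n, Matrix (V n) (V n) ℝ} {π : ∀ n, V n → ℝ} {N : ∀ n, V n → Finset (V n)}
  {Δ : ℕ} {c : ℝ} {L : ℕ → ℝ}

theorem exists_worstTV_le (h : IsExpandingSequence K π N Δ c L) {ε : ℝ} (hε : ε ∈ Set.Ioo 0 1)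
    (n : ℕ) : 0 ≤ (Real.log Δ + L n - Real.log ε) / c ∧
      worstTV (K n) (π n) ((Real.log Δ + L n - Real.log ε) / c) ≤ ε := by
  have hl : 0 ≤ Real.log Δ + L n :=
    add_nonneg (Real.log_natCast_nonneg Δ) (h.nonneg n)
  have h1 := (h.chain n).worstTV_le h.gap_pos (h.poincare n) (Real.one_le_exp hl) (h.le_mass n)
    hε.1 hε.2.le
  rw [Real.log_div (Real.exp_pos _).ne' hε.1.ne', Real.log_exp] at h1
  exact ⟨div_nonneg (by linarith [Real.log_nonpos hε.1.le hε.2.le]) h.gap_pos.le, h1⟩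

theorem worstTV_tmix_le (h : IsExpandingSequence K π N Δ c L) {ε : ℝ} (hε : ε ∈ Set.Ioo 0 1)
    (n : ℕ) : worstTV (K n) (π n) (tmix (K n) (π n) ε) ≤ ε :=
  IsReversibleChain.worstTV_tmix_le ⟨_, h.exists_worstTV_le hε n⟩

/-- Mixing takes at most logarithmic time. -/
theorem exists_tmix_le (h : IsExpandingSequence K π N Δ c L) {ε : ℝ} (hε : ε ∈ Set.Ioo 0 1) :
    ∃ C > 0, ∀ᶠ n in atTop, tmix (K n) (π n) ε ≤ C * L n := by
  refine ⟨2 / c, div_pos two_pos h.gap_pos, ?_⟩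
  filter_upwards [h.tendsto.eventually_ge_atTop (Real.log Δ - Real.log ε)] with n hn
  obtain ⟨h1, h2⟩ := h.exists_worstTV_le hε n
  refine (tmix_le h1 h2).trans ?_
  rw [div_mul_eq_mul_div]
  exact div_le_div_of_nonneg_right (by linarith) h.gap_pos.le

/-- Mixing takes at least logarithmic time. -/
theorem exists_le_tmix (h : IsExpandingSequence K π N Δ c L) {ε : ℝ} (hε : ε ∈ Set.Ioo 0 1) :
    ∃ a > 0, ∀ᶠ n in atTop, a * L n ≤ tmix (K n) (π n) ε := by
  set l := Real.log (1 + Δ) with hl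
  have hΔ : (1 : ℝ) ≤ Δ := by exact_mod_cast h.one_le
  have hl0 : 0 < l := Real.log_pos (by linarith)
  have hε0 : 0 < 1 - ε := by linarith [hε.2]
  -- With `m ≤ β L`, a ball of radius `m` has at most `exp (L / 2)` points, hence vanishing
  -- `π`-mass.
  set β := (2 * l)⁻¹ with hβ
  have hβ0 : 0 < β := by positivity
  refine ⟨β / 2 * ((1 - ε) / 2), by positivity, ?_⟩
  have hlim : Tendsto (fun n => (Δ : ℝ) * Real.exp (-(L n / 2))) atTop (𝓝 0) := by
    rw [← mul_zero (Δ : ℝ)]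
    exact (Real.tendsto_exp_neg_atTop_nhds_zero.comp
      (h.tendsto.atTop_div_const two_pos)).const_mul _
  filter_upwards [hlim.eventually_le_const (show 0 < (1 - ε) / 2 by positivity),
    h.tendsto.eventually_ge_atTop (2 / β)] with n h1 h2
  have hβL : 2 ≤ β * L n := by
    rw [div_le_iff₀ hβ0] at h2
    linarith
  set m := ⌊β * L n⌋₊ with hm
  have hm1 : (m : ℝ) ≤ β * L n := Nat.floor_le (by linarith)
  have hm2 : β * L n < m + 1 := Nat.lt_floor_add_one _
  have hm0 : 0 < m := by
    have : (0 : ℝ) < m := by linarith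
    exact_mod_cast this
  have hm0' : (0 : ℝ) < m := by exact_mod_cast hm0
  have h3 := (h.chain n).le_of_worstTV (h.eq_zero n) (h.card_le n) (h.mass_le n) (by positivity)
    hm0 (tmix_nonneg (K n) (π n) ε)
  have h4 := h.worstTV_tmix_le hε n
  have h5 : (1 + Δ : ℝ) ^ m ≤ Real.exp (L n / 2) := by
    rw [← Real.exp_log (show (0 : ℝ) < 1 + Δ by linarith), ← hl, ← Real.exp_nat_mul,
      Real.exp_le_exp]
    calc (m : ℝ) * l ≤ β * L n * l := by gcongr
      _ = L n / 2 := by rw [hβ]; field_simp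
  have h6 : (1 + Δ : ℝ) ^ m * (Δ * Real.exp (-L n)) ≤ Δ * Real.exp (-(L n / 2)) := by
    calc (1 + Δ : ℝ) ^ m * (Δ * Real.exp (-L n))
        ≤ Real.exp (L n / 2) * (Δ * Real.exp (-L n)) := by gcongr
      _ = Δ * (Real.exp (L n / 2) * Real.exp (-L n)) := by ring
      _ = Δ * Real.exp (-(L n / 2)) := by rw [← Real.exp_add]; congr 2; ring
  have h7 : (1 - ε) / 2 ≤ tmix (K n) (π n) ε / m := by linarith
  rw [le_div_iff₀ hm0'] at h7
  refine le_trans ?_ h7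
  rw [mul_right_comm, mul_comm]
  exact mul_le_mul_of_nonneg_left (by linarith) (by positivity)

/-- This is `tmix_le_add` started at the mixing time of level `ε' = 1 - δ`. No order between `ε` and
`ε'` is imposed, so exchanging them bounds the difference on both sides. -/
theorem tmix_sub_le (h : IsExpandingSequence K π N Δ c L) {ε ε' : ℝ} (hε : ε ∈ Set.Ioo 0 1)
    (hε' : ε' ∈ Set.Ioo 0 1)
    (hV : Tendsto (fun n => worstVarentropy (K n) (π n) (tmix (K n) (π n) ε') / L n ^ 2) atTop
      (𝓝 0)) :
    ∃ u : ℕ → ℝ, Tendsto u atTop (𝓝 0) ∧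
      ∀ᶠ n in atTop, (tmix (K n) (π n) ε - tmix (K n) (π n) ε') / L n ≤ u n := by
  set δ := 1 - ε' with hδ
  have hδ0 : 0 < δ := by linarith [hε'.2]
  have hδ1 : δ ≤ 1 := by linarith [hε'.1]
  set η := min (δ / 2) (ε / 2) with hη
  have hη0 : 0 < η := lt_min (by positivity) (half_pos hε.1)
  set C := Real.log (2 / (δ * ε))
  let W : ℕ → ℝ := fun n => worstVarentropy (K n) (π n) (tmix (K n) (π n) ε')
  have hW : ∀ n, 0 ≤ W n := fun n => Real.iSup_nonneg fun o =>
    varentropy_nonneg fun x => (h.chain n).heatKernel_nonneg (tmix_nonneg _ _ _) o x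
  refine ⟨fun n => (2 + C) / c * (L n)⁻¹ + 2 / c * Real.sqrt (W n / L n ^ 2 / η), ?_, ?_⟩
  · have h1 := (h.tendsto.inv_tendsto_atTop).const_mul ((2 + C) / c)
    have h2 := ((hV.div_const η).sqrt).const_mul (2 / c)
    simpa using h1.add h2
  · filter_upwards [h.tendsto.eventually_gt_atTop 0] with n hn
    have hb0 : 0 ≤ Real.sqrt (W n / η) := Real.sqrt_nonneg _
    -- The summand `1` in `b` keeps it positive when the varentropy vanishes.
    have h1 := (h.chain n).tmix_le_add h.gap_pos (h.poincare n) (tmix_nonneg (K n) (π n) ε')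
      hδ0 hδ1 hε.1 hε.2.le (b := 1 + Real.sqrt (W n / η)) (by positivity) (min_le_left _ _)
      (min_le_right _ _) (by rw [hδ, sub_sub_cancel]; exact h.worstTV_tmix_le hε' n) (by
        have h2 : W n / η ≤ (1 + Real.sqrt (W n / η)) ^ 2 := by
          nlinarith [Real.sq_sqrt (div_nonneg (hW n) hη0.le)]
        rwa [div_le_iff₀ hη0] at h2)
    have h2 : Real.sqrt (W n / L n ^ 2 / η) = Real.sqrt (W n / η) / L n := by
      rw [div_right_comm, Real.sqrt_div (div_nonneg (hW n) hη0.le), Real.sqrt_sq hn.le]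
    have hc := h.gap_pos
    rw [h2, div_le_iff₀ hn]
    calc tmix (K n) (π n) ε - tmix (K n) (π n) ε'
        ≤ (2 * (1 + Real.sqrt (W n / η)) + C) / c := by linarith
      _ = _ := by field_simp; ring

theorem exhibitsCutoff (h : IsExpandingSequence K π N Δ c L)
    (hV : ∀ ε ∈ Set.Ioo (0 : ℝ) 1,
      Tendsto (fun n => worstVarentropy (K n) (π n) (tmix (K n) (π n) ε) / L n ^ 2) atTop (𝓝 0)) :
    ExhibitsCutoff K π := by
  intro ε hε ε' hε'
  obtain ⟨u, hu, hu'⟩ := h.tmix_sub_le hε hε' (hV ε' hε')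
  obtain ⟨v, hv, hv'⟩ := h.tmix_sub_le hε' hε (hV ε hε)
  obtain ⟨a, ha, ha'⟩ := h.exists_le_tmix hε
  have h1 : Tendsto (fun n => (tmix (K n) (π n) ε' - tmix (K n) (π n) ε) / L n) atTop (𝓝 0) := by
    refine tendsto_of_tendsto_of_tendsto_of_le_of_le' (by simpa using hu.neg) hv ?_ hv'
    filter_upwards [hu'] with n hn
    rw [← neg_sub, neg_div]
    linarith
  -- A difference of order `o(L)` is negligible against a mixing time of at least `a L`.
  have h2 : Tendsto (fun n => tmix (K n) (π n) ε' / tmix (K n) (π n) ε - 1) atTop (𝓝 0) := by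
    refine squeeze_zero_norm' ?_ (show Tendsto (fun n =>
      |(tmix (K n) (π n) ε' - tmix (K n) (π n) ε) / L n| / a) atTop (𝓝 0) by
        simpa using h1.abs.div_const a)
    filter_upwards [ha', h.tendsto.eventually_gt_atTop 0] with n hn hL
    have hT : 0 < tmix (K n) (π n) ε := lt_of_lt_of_le (by positivity) hn
    rw [Real.norm_eq_abs, div_sub_one hT.ne', abs_div, abs_div, abs_of_pos hT, abs_of_pos hL,
      div_div]
    gcongr
    linarith
  simpa using h2.add_const 1

theorem tendsto_worstVarentropy (h : IsExpandingSequence K π N Δ c L)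
    (hcut : ExhibitsCutoff K π) {ε : ℝ} (hε : ε ∈ Set.Ioo (0 : ℝ) 1) :
    Tendsto (fun n => worstVarentropy (K n) (π n) (tmix (K n) (π n) ε) / L n ^ 2) atTop
      (𝓝 0) := by
  let W : ℕ → ℝ := fun n => worstVarentropy (K n) (π n) (tmix (K n) (π n) ε)
  have hW : ∀ n, 0 ≤ W n := fun n => Real.iSup_nonneg fun o =>
    varentropy_nonneg fun x => (h.chain n).heatKernel_nonneg (tmix_nonneg _ _ _) o x
  rw [tendsto_order]
  refine ⟨fun r hr => .of_forall fun n => hr.trans_le (div_nonneg (hW n) (sq_nonneg _)),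
    fun ρ hρ => ?_⟩
  set l := Real.log (1 + Δ) with hl
  have hΔ : (1 : ℝ) ≤ Δ := by exact_mod_cast h.one_le
  have hl0 : 0 < l := Real.log_pos (by linarith)
  -- Budget: `k ^ 2 = ρ / 4` and `4 η ≤ ρ / 4` leave room below `ρ`. The choice `ζ = k / (2 l)`
  -- limits the growth of a thickening to about `exp (k L / 2)`, beaten by the factor `exp (-k L)`
  -- from the size of `A`.
  set k := Real.sqrt (ρ / 4) with hk
  have hk0 : 0 < k := Real.sqrt_pos.2 (by positivity)
  have hk2 : k ^ 2 = ρ / 4 := Real.sq_sqrt (by positivity)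
  set η := min (ρ / 16) ε with hη
  have hη0 : 0 < η := lt_min (by positivity) hε.1
  have hηε : η ≤ ε := min_le_right _ _
  have hη1 : η ∈ Set.Ioo (0 : ℝ) 1 := ⟨hη0, hηε.trans_lt hε.2⟩
  set ζ := k / (2 * l) with hζ
  have hζ0 : 0 < ζ := by positivity
  let s : ℕ → ℝ := fun n => tmix (K n) (π n) η - tmix (K n) (π n) ε
  have hs0 : ∀ n, 0 ≤ s n := fun n => sub_nonneg.2
    (IsReversibleChain.tmix_anti hηε ⟨_, h.exists_worstTV_le hη1 n⟩)
  have hs : Tendsto (fun n => s n / L n) atTop (𝓝 0) := by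
    obtain ⟨C, hC, hC'⟩ := h.exists_tmix_le hε
    obtain ⟨a, ha, ha'⟩ := h.exists_le_tmix hε
    -- Cutoff compares the window with the mixing time; the bound `C L` on the latter converts this
    -- to `o(L)`.
    have h1 := ((hcut ε hε η hη1).sub_const 1).mul_const C
    rw [sub_self, zero_mul] at h1
    refine tendsto_of_tendsto_of_tendsto_of_le_of_le' tendsto_const_nhds h1
      (.of_forall fun n => div_nonneg (hs0 n) (h.nonneg n)) ?_
    filter_upwards [hC', ha', h.tendsto.eventually_gt_atTop 0] with n hn hn' hL
    have hT : 0 < tmix (K n) (π n) ε := lt_of_lt_of_le (by positivity) hn'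
    rw [div_sub_one hT.ne', div_le_iff₀ hL, mul_assoc, div_mul_eq_mul_div, le_div_iff₀ hT]
    exact mul_le_mul_of_nonneg_left hn (hs0 n)
  have hexp : Tendsto (fun n => (Δ : ℝ) ^ 2 * (1 + Δ) * Real.exp (-(k / 2 * L n))) atTop
      (𝓝 0) := by
    simpa using (Real.tendsto_exp_neg_atTop_nhds_zero.comp
      (h.tendsto.const_mul_atTop (half_pos hk0))).const_mul ((Δ : ℝ) ^ 2 * (1 + Δ))
  have hinv : Tendsto (fun n => (L n)⁻¹) atTop (𝓝 0) := h.tendsto.inv_tendsto_atTop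
  have hlim : Tendsto (fun n => k ^ 2 + 4 * (η + s n / L n / ζ +
      (Δ : ℝ) ^ 2 * (1 + Δ) * Real.exp (-(k / 2 * L n))) + 4 * (L n)⁻¹ ^ 2) atTop
      (𝓝 (k ^ 2 + 4 * (η + 0 / ζ + 0) + 4 * 0 ^ 2)) :=
    (tendsto_const_nhds.add (((tendsto_const_nhds.add (hs.div_const ζ)).add hexp).const_mul 4)).add
      ((hinv.pow 2).const_mul 4)
  have hlt : k ^ 2 + 4 * (η + 0 / ζ + 0) + 4 * 0 ^ 2 < ρ := by
    have : η ≤ ρ / 16 := min_le_left _ _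
    rw [hk2, zero_div]
    linarith
  filter_upwards [hlim.eventually_lt_const hlt, h.tendsto.eventually_gt_atTop 0,
    h.tendsto.eventually_ge_atTop (Real.log Δ)] with n hn hL hL2
  refine lt_of_le_of_lt ?_ hn
  set m := ⌈ζ * L n⌉₊ with hm
  have hm1 : ζ * L n ≤ m := Nat.le_ceil _
  have hm2 : (m : ℝ) < ζ * L n + 1 := Nat.ceil_lt_add_one (by positivity)
  have hm0 : 0 < m := Nat.ceil_pos.2 (by positivity)
  have h1 := (h.chain n).worstVarentropy_le (h.eq_zero n) (h.card_le n) (κ := k * L n)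
    (h.mass_le n) (by positivity) (h.le_mass n) hm0 (hs0 n) (tmix_nonneg (K n) (π n) ε)
  rw [show tmix (K n) (π n) ε + s n = tmix (K n) (π n) η by simp [s]] at h1
  have h2 := h.worstTV_tmix_le hη1 n
  have h3 : s n / m ≤ s n / L n / ζ := by
    rw [div_div, mul_comm (L n)]
    exact div_le_div_of_nonneg_left (hs0 n) (by positivity) hm1
  have h4 : (1 + Δ : ℝ) ^ m ≤ (1 + Δ) * Real.exp (k / 2 * L n) := by
    rw [← Real.exp_log (show (0 : ℝ) < 1 + Δ by linarith), ← hl, ← Real.exp_nat_mul,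
      ← Real.exp_add, Real.exp_le_exp]
    calc (m : ℝ) * l ≤ (ζ * L n + 1) * l := by gcongr
      _ = l + k / 2 * L n := by rw [hζ]; field_simp; ring
  have h5 : (1 + Δ : ℝ) ^ m * (Real.exp (Real.log Δ + L n) * Real.exp (-(k * L n))) *
      (Δ * Real.exp (-L n)) ≤ (Δ : ℝ) ^ 2 * (1 + Δ) * Real.exp (-(k / 2 * L n)) := by
    calc (1 + Δ : ℝ) ^ m * (Real.exp (Real.log Δ + L n) * Real.exp (-(k * L n))) *
          (Δ * Real.exp (-L n))
        ≤ (1 + Δ) * Real.exp (k / 2 * L n) * (Real.exp (Real.log Δ + L n) *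
          Real.exp (-(k * L n))) * (Δ * Real.exp (-L n)) := by gcongr
      _ = (Δ : ℝ) ^ 2 * (1 + Δ) * (Real.exp (k / 2 * L n) * Real.exp (L n) *
          Real.exp (-(k * L n)) * Real.exp (-L n)) := by
        rw [Real.exp_add, Real.exp_log (by linarith)]; ring
      _ = _ := by
        rw [← Real.exp_add, ← Real.exp_add, ← Real.exp_add]
        congr 2
        ring
  have hΛ0 : 0 ≤ Real.log Δ + L n := add_nonneg (Real.log_natCast_nonneg Δ) hL.le
  -- Once `L n ≥ log Δ`, the maximal log-density is at most `2 L n`; hence the factor `4`.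
  have hΛ : (Real.log Δ + L n) ^ 2 ≤ 4 * L n ^ 2 := by nlinarith
  set E := (Δ : ℝ) ^ 2 * (1 + Δ) * Real.exp (-(k / 2 * L n)) with hE
  have hE0 : 0 ≤ E := by positivity
  have h6 : 0 ≤ η + s n / L n / ζ + E := by
    have := hs0 n
    positivity
  have h7 : W n ≤ (k * L n) ^ 2 + 4 * L n ^ 2 * (η + s n / L n / ζ + E) + 4 := by
    refine h1.trans ?_
    have h8 := mul_le_mul_of_nonneg_left (add_le_add (add_le_add h2 h3) h5)
      (sq_nonneg (Real.log Δ + L n))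
    have h9 := mul_le_mul_of_nonneg_right hΛ h6
    linarith
  rw [div_le_iff₀ (by positivity)]
  refine h7.trans (le_of_eq ?_)
  have : L n ≠ 0 := hL.ne'
  have e : (L n)⁻¹ ^ 2 * L n ^ 2 = 1 := by field_simp
  linear_combination (-4) * e

end IsExpandingSequence

end MarkovCutoff

theorem mainTheorem2 {V : ℕ → Type*} [∀ n, Fintype (V n)] [∀ n, DecidableEq (V n)]
    [∀ n, Nontrivial (V n)] (G : ∀ n, SimpleGraph (V n)) [∀ n, DecidableRel (G n).Adj]
    (hG : MarkovCutoff.IsExpanderSequence G) :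
    MarkovCutoff.ExhibitsCutoff (fun n => MarkovCutoff.srw (G n))
        (fun n => MarkovCutoff.srwStationary (G n)) ↔
      ∀ ε ∈ Set.Ioo (0 : ℝ) 1,
        Tendsto (fun n =>
          MarkovCutoff.worstVarentropy (MarkovCutoff.srw (G n)) (MarkovCutoff.srwStationary (G n))
              (MarkovCutoff.tmix (MarkovCutoff.srw (G n)) (MarkovCutoff.srwStationary (G n)) ε) /
            Real.log (Fintype.card (V n)) ^ 2) atTop (𝓝 0) := by
  obtain ⟨_, _, h⟩ := hG.isExpandingSequence
  exact ⟨fun hcut ε hε => h.tendsto_worstVarentropy hcut hε, fun hV => h.exhibitsCutoff hV⟩
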